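/- Let $\mathbb K$ be $\mathbb R$ or $\mathbb C$, let $w=\mathbb K^{\mathbb N_0}$, where $\mathbb N_0=\{0,1,2,\dots\}$ and $\mathbb N=\{1,2,\dots\}$, and let $p=(p_k)_{k\ge 0}$ be a bounded sequence of strictly positive real numbers. Put $l(p)=\{x\in w:\sum_k|x_k|^{p_k}<\infty\}$, $c_0(p)=\{x\in w:\lim_k|x_k|^{p_k}=0\}$, $c(p)=\{x\in w:\lim_k|x_k-l|^{p_k}=0\text{ for some }l\in\mathbb K\}$ and $l_\infty(p)=\{x\in w:\sup_k|x_k|^{p_k}<\infty\}$. Let $r,s,t\in w$ with $r_n\neq0$ and $t_n\neq0$ for all $n$, and $s_0\ne0$. For $X\in\{l(p),c_0(p),c(p),l_\infty(p)\}$ let $$X(r,s,t,p;\Delta)=\Big\{x\in w:\Big(\frac1{r_n}\sum_{k=0}^{n}s_{n-k}t_k\,\Delta x_k\Big)_{n}\in X\Big\},\qquad \Delta x_k=x_k-x_{k-1},\ x_{-1}=0,$$ and denote these spaces by $l(r,s,t,p;\Delta)$, $c_0(r,s,t,p;\Delta)$, $c(r,s,t,p;\Delta)$ and $l_\infty(r,s,t,p;\Delta)$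 respectively. The $\alpha$-dual of $U\subseteq w$ is $U^\alpha=\{a\in w:\sum_n|a_nu_n|<\infty\text{ for all }u\in U\}$. Let $D^{(s)}_0=1/s_0$ and, for $n\ge1$, $D^{(s)}_n=s_0^{-(n+1)}\det(d_{ij})_{1\le i,j\le n}$, where $d_{ij}=s_{i-j+1}$ if $j\le i+1$ and $d_{ij}=0$ otherwise. For $a\in w$ put $$c_{nk}=\sum_{j=0}^{n-k}(-1)^j\frac{D^{(s)}_j}{t_{j+k}}\,r_ka_n\quad(0\le k\le n),\qquad c_{nk}=0\quad(k>n).$$ With $F$ running over the finite subsets of $\mathbb N_0$, and $p_k'=p_k/(p_k-1)$ when $p_k>1$, let \begin{align*} H_1(p)&=\bigcup_{L\in\mathbb N}\Big\{a\in w:\sup_F\sum_{n=0}^\infty\Big|\sum_{k\in F}c_{nk}L^{-1/p_k}\Big|<\infty\Big\},\\ H_2(p)&=\Big\{a\in w:\sum_{n=0}^\infty\Big|\sum_{k=0}^\infty c_{nk}\Big|<\infty\Big\},\\ H_3(p)&=\bigcap_{L\in\mathbb N}\Big\{a\in w:\sup_F\sum_{n=0}^\infty\Big|\sum_{k\in F}c_{nk}L^{1/p_k}\Big|<\infty\Big\},\\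 H_4(p)&=\Big\{a\in w:\sup_F\sup_{k\in\mathbb N_0}\Big|\sum_{n\in F}c_{nk}\Big|^{p_k}<\infty\Big\},\\ H_5(p)&=\bigcup_{L\in\mathbb N}\Big\{a\in w:\sup_F\sum_{k=0}^\infty\Big|\sum_{n\in F}c_{nk}L^{-1}\Big|^{p_k'}<\infty\Big\}. \end{align*} Then: (a) if $p_k>1$ for all $k$, then $[l(r,s,t,p;\Delta)]^\alpha=H_5(p)$; if $0<p_k\le1$ for all $k$, then $[l(r,s,t,p;\Delta)]^\alpha=H_4(p)$; (b) for every such $p$: (i) $[c_0(r,s,t,p;\Delta)]^\alpha=H_1(p)$; (ii) $[c(r,s,t,p;\Delta)]^\alpha=H_1(p)\cap H_2(p)$; (iii) $[l_\infty(r,s,t,p;\Delta)]^\alpha=H_3(p)$. -/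

import Mathlib

namespace GenMeans

variable {𝕜 : Type*} [RCLike 𝕜]

/-- The Maddox space `l(p)`. -/
def lp (p : ℕ → ℝ) : Set (ℕ → 𝕜) := {x | Summable fun k => ‖x k‖ ^ p k}

/-- The Maddox space `c₀(p)`. -/
def c0 (p : ℕ → ℝ) : Set (ℕ → 𝕜) :=
  {x | Filter.Tendsto (fun k => ‖x k‖ ^ p k) Filter.atTop (nhds 0)}

/-- The Maddox space `c(p)`. -/
def c (p : ℕ → ℝ) : Set (ℕ → 𝕜) :=
  {x | ∃ l : 𝕜, Filter.Tendsto (fun k => ‖x k - l‖ ^ p k) Filter.atTop (nhds 0)}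

/-- The Maddox space `l_∞(p)`. -/
def linf (p : ℕ → ℝ) : Set (ℕ → 𝕜) := {x | BddAbove (Set.range fun k => ‖x k‖ ^ p k)}

/-- The space `l₁` of absolutely summable sequences. -/
def l1 : Set (ℕ → 𝕜) := {x | Summable fun k => ‖x k‖}

/-- The multiplier space `M(U, V)`. -/
def multiplier (U V : Set (ℕ → 𝕜)) : Set (ℕ → 𝕜) :=
  {a | ∀ u ∈ U, (fun n => a n * u n) ∈ V}

/-- The `α`-dual of a set of sequences. -/
def alphaDual (U : Set (ℕ → 𝕜)) : Set (ℕ → 𝕜) := multiplier U l1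

/-- The difference operator `(Δ x)ₖ = xₖ - xₖ₋₁`, with `x₋₁ = 0`. -/
def diff (x : ℕ → 𝕜) : ℕ → 𝕜
  | 0 => x 0
  | k + 1 => x (k + 1) - x k

/-- The generalized means of a sequence. -/
noncomputable def genMean (r s t x : ℕ → 𝕜) (n : ℕ) : 𝕜 :=
  1 / r n * ∑ k ∈ Finset.range (n + 1), s (n - k) * t k * x k

/-- The space `X(r, s, t; Δ)` of all `x` for which the generalized means of `Δ x` form a member
of `X`. -/
def space (X : Set (ℕ → 𝕜)) (r s t : ℕ → 𝕜) : Set (ℕ → 𝕜) :=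
  {x | genMean r s t (diff x) ∈ X}

/-- The number `Dₙ⁽ˢ⁾`: the determinant of the `n × n` matrix with `s₁` on the diagonal, `s₀` just
above it and `s_{i-j+1}` below it, divided by `s₀ⁿ⁺¹`. For `n = 0` it is `1 / s₀`. -/
noncomputable def D (s : ℕ → 𝕜) (n : ℕ) : 𝕜 :=
  1 / s 0 ^ (n + 1) *
    (Matrix.of fun i j : Fin n =>
      if (j : ℕ) ≤ (i : ℕ) + 1 then s ((i : ℕ) + 1 - (j : ℕ)) else 0).det

/-- The entry `∑_{j=0}^{n-k} (-1)ʲ Dⱼ⁽ˢ⁾ / t_{j+k} · rₖ aₙ`, an empty sum if `k > n`. -/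
noncomputable def C (r s t a : ℕ → 𝕜) (n k : ℕ) : 𝕜 :=
  if k ≤ n then
    ∑ j ∈ Finset.range (n - k + 1), (-1) ^ j * (D s j / t (j + k)) * r k * a n
  else 0

noncomputable def H1 (r s t : ℕ → 𝕜) (p : ℕ → ℝ) : Set (ℕ → 𝕜) :=
  {a | ∃ L : ℕ, 0 < L ∧
    (⨆ F : Finset ℕ, ∑' n, ‖∑ k ∈ F, C r s t a n k * (((L : ℝ) ^ (-1 / p k) : ℝ) : 𝕜)‖ₑ) < ⊤}

noncomputable def H2 (r s t : ℕ → 𝕜) : Set (ℕ → 𝕜) :=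
  {a | (∑' n, ‖∑' k, C r s t a n k‖ₑ) < ⊤}

noncomputable def H3 (r s t : ℕ → 𝕜) (p : ℕ → ℝ) : Set (ℕ → 𝕜) :=
  {a | ∀ L : ℕ, 0 < L →
    (⨆ F : Finset ℕ, ∑' n, ‖∑ k ∈ F, C r s t a n k * (((L : ℝ) ^ (1 / p k) : ℝ) : 𝕜)‖ₑ) < ⊤}

noncomputable def H4 (r s t : ℕ → 𝕜) (p : ℕ → ℝ) : Set (ℕ → 𝕜) :=
  {a | (⨆ F : Finset ℕ, ⨆ k : ℕ, ‖∑ n ∈ F, C r s t a n k‖ₑ ^ p k) < ⊤}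

noncomputable def H5 (r s t : ℕ → 𝕜) (p : ℕ → ℝ) : Set (ℕ → 𝕜) :=
  {a | ∃ L : ℕ, 0 < L ∧
    (⨆ F : Finset ℕ, ∑' k, ‖∑ n ∈ F, C r s t a n k * (L : 𝕜)⁻¹‖ₑ ^ (p k / (p k - 1))) < ⊤}

end GenMeans

/-!
The numbers `(-1) ^ n * D s n` are the coefficients of the inverse of the power series of `s`, by
Cramer's rule for its lower triangular Toeplitz matrix. Hence `a n * x n` is the `n`-th term of the
`C`-transform of `y = genMean r s t (diff x)`, every sequence `y` arises in this way, and `a` lies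
in the `α`-dual of the space over `X` if and only if the row-finite matrix `C` maps `X` into `l₁`.

For sufficiency, an `l₁` norm is at most four times the supremum of the absolute values of the
finite subsums; this exchanges the order of summation and leaves a termwise estimate. For necessity,
take a sequence of bounded sets whose members can be glued, block by block, to an element of `X`. A
gliding hump shows that on one of these sets the transforms of the sequences vanishing on a long
initial block are bounded by `1` in `l₁`; testing this on finitely supported sequences, for `1 < pₖ`
on the norming ones of Hölder's inequality, gives the condition.
-/

namespace GenMeans

open Filter Finset Matrix
open scoped ENNReal PowerSeries

section Toeplitz

variable {R : Type*} [CommRing R]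

/-- The lower triangular Toeplitz matrix of size `n` with the entries `s 0, …, s (n - 1)` in its
first column: multiplication by the power series of `s`, truncated to the first `n` coefficients. -/
def toeplitz (s : ℕ → R) (n : ℕ) : Matrix (Fin n) (Fin n) R :=
  of fun i j => if (j : ℕ) ≤ i then s (i - j) else 0

theorem det_toeplitz (s : ℕ → R) (n : ℕ) : (toeplitz s n).det = s 0 ^ n := by
  rw [det_of_isLowerTriangular]
  · simp [toeplitz]
  · intro i j hij
    exact if_neg (not_le.2 hij)

theorem toeplitz_mulVec_coeff (s : ℕ → R) (n : ℕ) (f : R⟦X⟧) (i : Fin n) :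
    (toeplitz s n *ᵥ fun j => PowerSeries.coeff j f) i =
      PowerSeries.coeff i (PowerSeries.mk s * f) := by
  have hrange : (toeplitz s n *ᵥ fun j => PowerSeries.coeff j f) i =
      ∑ j ∈ range n, (if j ≤ (i : ℕ) then s (i - j) else 0) * PowerSeries.coeff j f := by
    rw [sum_range]
    rfl
  rw [hrange, mul_comm, PowerSeries.coeff_mul, Nat.sum_antidiagonal_eq_sum_range_succ_mk]
  symm
  refine sum_subset_zero_on_sdiff (range_subset_range.2 i.2) (fun j hj => ?_) fun j hj => ?_
  · simp only [Finset.mem_sdiff, mem_range, Nat.lt_succ_iff] at hj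
    rw [if_neg hj.2, zero_mul]
  · rw [if_pos (Nat.lt_succ_iff.1 (mem_range.1 hj)), mul_comm, PowerSeries.coeff_mk]

theorem adjugate_toeplitz_last_zero (s : ℕ → R) (n : ℕ) :
    (toeplitz s (n + 1)).adjugate (Fin.last n) 0 =
      (-1) ^ n * (of fun i j : Fin n =>
        if (j : ℕ) ≤ (i : ℕ) + 1 then s ((i : ℕ) + 1 - (j : ℕ)) else 0).det := by
  rw [adjugate_fin_succ_eq_det_submatrix]
  congr 2
  · simp
  · ext i j
    simp only [toeplitz, submatrix_apply, of_apply, Fin.succAbove_zero, Fin.val_succ,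
      Fin.succAbove_last, Fin.val_castSucc]

end Toeplitz

variable {𝕜 : Type*} [RCLike 𝕜]

theorem coeff_inv_mk {s : ℕ → 𝕜} (hs : s 0 ≠ 0) (n : ℕ) :
    PowerSeries.coeff n (PowerSeries.mk s)⁻¹ = (-1) ^ n * D s n := by
  set v : Fin (n + 1) → 𝕜 := fun j => PowerSeries.coeff j (PowerSeries.mk s)⁻¹
  have hv : toeplitz s (n + 1) *ᵥ v = Pi.single 0 1 := by
    funext i
    rw [toeplitz_mulVec_coeff, PowerSeries.mul_inv_cancel _ (by simpa using hs),
      PowerSeries.coeff_one]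
    rcases eq_or_ne i 0 with rfl | hi
    · simp
    · simp [hi]
  have hcramer : s 0 ^ (n + 1) * v (Fin.last n) =
      (toeplitz s (n + 1)).adjugate (Fin.last n) 0 := by
    have h := congrArg (fun u => ((toeplitz s (n + 1)).adjugate *ᵥ u) (Fin.last n)) hv
    simpa [mulVec_mulVec, adjugate_mul, smul_mulVec, det_toeplitz] using h
  rw [adjugate_toeplitz_last_zero] at hcramer
  have hs' : s 0 ^ (n + 1) ≠ 0 := pow_ne_zero _ hs
  calc PowerSeries.coeff n (PowerSeries.mk s)⁻¹ = v (Fin.last n) := by simp [v]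
    _ = (-1) ^ n * D s n := by
      rw [D, mul_left_comm, ← hcramer]
      field_simp

theorem genMean_eq_iff {r s : ℕ → 𝕜} (hr : ∀ n, r n ≠ 0) (hs : s 0 ≠ 0) (t u y : ℕ → 𝕜) :
    genMean r s t u = y ↔
      ∀ m, t m * u m = ∑ k ∈ range (m + 1), (-1) ^ (m - k) * D s (m - k) * (r k * y k) := by
  have hconv : genMean r s t u = y ↔
      PowerSeries.mk (fun k => t k * u k) * PowerSeries.mk s =
        PowerSeries.mk (fun k => r k * y k) := by
    rw [funext_iff, PowerSeries.ext_iff]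
    refine forall_congr' fun n => ?_
    simp only [PowerSeries.coeff_mul, Nat.sum_antidiagonal_eq_sum_range_succ_mk,
      PowerSeries.coeff_mk, genMean]
    rw [one_div, inv_mul_eq_iff_eq_mul₀ (hr n)]
    have hcomm (k : ℕ) : s (n - k) * t k * u k = t k * u k * s (n - k) := by ring
    simp only [hcomm]
  rw [hconv, ← PowerSeries.eq_mul_inv_iff_mul_eq (by simpa using hs), PowerSeries.ext_iff]
  refine forall_congr' fun n => ?_
  simp only [PowerSeries.coeff_mul, Nat.sum_antidiagonal_eq_sum_range_succ_mk,
    PowerSeries.coeff_mk, coeff_inv_mk hs, mul_comm (r _ * y _)]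

theorem genMean_surjective {r s t : ℕ → 𝕜} (hr : ∀ n, r n ≠ 0) (hs : s 0 ≠ 0)
    (ht : ∀ n, t n ≠ 0) : Function.Surjective (genMean r s t) := fun y =>
  ⟨fun m => (∑ k ∈ range (m + 1), (-1) ^ (m - k) * D s (m - k) * (r k * y k)) / t m,
    (genMean_eq_iff hr hs _ _ _).2 fun m => mul_div_cancel₀ _ (ht m)⟩

theorem sum_range_diff (x : ℕ → 𝕜) (n : ℕ) : ∑ k ∈ range (n + 1), diff x k = x n := by
  induction n with
  | zero => simp [diff]
  | succ n ih => rw [sum_range_succ, ih, diff, add_sub_cancel]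

theorem diff_surjective : Function.Surjective (diff : (ℕ → 𝕜) → ℕ → 𝕜) := fun u =>
  ⟨fun n => ∑ k ∈ range (n + 1), u k, by
    funext n
    cases n <;> simp [diff, sum_range_succ]⟩

theorem C_eq_zero_of_lt (r s t a : ℕ → 𝕜) {n k : ℕ} (h : n < k) : C r s t a n k = 0 :=
  if_neg (not_le.2 h)

theorem C_eq_sum_Ico (r s t a : ℕ → 𝕜) (n k : ℕ) :
    C r s t a n k =
      ∑ m ∈ Ico k (n + 1), (-1) ^ (m - k) * D s (m - k) / t m * r k * a n := by
  rcases lt_or_ge n k with h | h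
  · rw [C_eq_zero_of_lt r s t a h, Ico_eq_empty (by omega), sum_empty]
  · rw [C, if_pos h, sum_Ico_eq_sum_range, Nat.sub_add_comm h]
    refine sum_congr rfl fun j _ => ?_
    rw [Nat.add_sub_cancel_left, add_comm k j, mul_div_assoc]

/-- The `A`-transform `(∑ₖ Aₙₖ yₖ)ₙ` of a sequence `y`, meant for matrices `A` with finite rows. -/
noncomputable def transform (A : ℕ → ℕ → 𝕜) (y : ℕ → 𝕜) (n : ℕ) : 𝕜 := ∑' k, A n k * y k

/-- The matrix `A` has only finitely many nonzero entries in each row. -/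
def RowFinite (A : ℕ → ℕ → 𝕜) : Prop := ∀ n, ∀ᶠ k in atTop, A n k = 0

theorem rowFinite_C (r s t a : ℕ → 𝕜) : RowFinite (C r s t a) := fun n =>
  (eventually_gt_atTop n).mono fun _ => C_eq_zero_of_lt r s t a

theorem transform_C_genMean_diff {r s t : ℕ → 𝕜} (hr : ∀ n, r n ≠ 0) (hs : s 0 ≠ 0)
    (ht : ∀ n, t n ≠ 0) (a x : ℕ → 𝕜) (n : ℕ) :
    transform (C r s t a) (genMean r s t (diff x)) n = a n * x n := by
  set y := genMean r s t (diff x) with hy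
  have hdiff (m : ℕ) : diff x m =
      (∑ k ∈ range (m + 1), (-1) ^ (m - k) * D s (m - k) * (r k * y k)) / t m := by
    rw [← (genMean_eq_iff hr hs t _ y).1 hy.symm m, mul_div_cancel_left₀ _ (ht m)]
  have hrow : ∀ k ∉ range (n + 1), C r s t a n k * y k = 0 := fun k hk => by
    rw [C_eq_zero_of_lt r s t a (by simpa using hk), zero_mul]
  calc transform (C r s t a) y n
      = ∑ k ∈ Ico 0 (n + 1), ∑ m ∈ Ico k (n + 1),
          (-1) ^ (m - k) * D s (m - k) / t m * r k * a n * y k := by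
        rw [transform, tsum_eq_sum hrow, range_eq_Ico]
        simp only [C_eq_sum_Ico, sum_mul]
    _ = ∑ m ∈ range (n + 1), a n * diff x m := by
        rw [sum_Ico_Ico_comm, ← range_eq_Ico]
        refine sum_congr rfl fun m _ => ?_
        rw [hdiff, sum_div, mul_sum, range_eq_Ico]
        exact sum_congr rfl fun k _ => by ring
    _ = a n * x n := by rw [← mul_sum, sum_range_diff]

theorem mem_alphaDual_space_iff {r s t : ℕ → 𝕜} (hr : ∀ n, r n ≠ 0) (hs : s 0 ≠ 0)
    (ht : ∀ n, t n ≠ 0) (X : Set (ℕ → 𝕜)) (a : ℕ → 𝕜) :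
    a ∈ alphaDual (space X r s t) ↔ Set.MapsTo (transform (C r s t a)) X l1 := by
  have hmul (x : ℕ → 𝕜) :
      transform (C r s t a) (genMean r s t (diff x)) = fun n => a n * x n :=
    funext (transform_C_genMean_diff hr hs ht a x)
  constructor
  · intro ha y hy
    obtain ⟨x, rfl⟩ := ((genMean_surjective hr hs ht).comp diff_surjective) y
    rw [Function.comp_apply, hmul]
    exact ha x hy
  · intro hA x hx
    rw [← hmul]
    exact hA hx

theorem mem_l1_iff {y : ℕ → 𝕜} : y ∈ l1 ↔ ∑' n, ‖y n‖ₑ ≠ ⊤ :=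
  tsum_enorm_ne_top_iff_summable_norm.symm

theorem mem_lp_iff {p : ℕ → ℝ} (hp : ∀ k, 0 < p k) {y : ℕ → 𝕜} :
    y ∈ lp p ↔ ∑' k, ‖y k‖ₑ ^ p k ≠ ⊤ := by
  have henorm (k : ℕ) : ‖y k‖ₑ ^ p k = ‖‖y k‖ ^ p k‖ₑ := by
    rw [Real.enorm_rpow_of_nonneg (norm_nonneg _) (hp k).le, enorm_norm]
  simp only [henorm]
  rw [tsum_enorm_ne_top_iff_summable_norm, summable_norm_iff]
  rfl

section Transform

variable {A : ℕ → ℕ → 𝕜}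

theorem RowFinite.summable_mul (hA : RowFinite A) (y : ℕ → 𝕜) (n : ℕ) :
    Summable fun k => A n k * y k := by
  refine summable_of_hasFiniteSupport ?_
  have hfin : {k | ¬A n k = 0}.Finite := by
    rw [← eventually_cofinite, Nat.cofinite_eq_atTop]
    exact hA n
  exact hfin.subset fun k hk hzero => hk (mul_eq_zero_of_left hzero (y k))

theorem RowFinite.transform_add (hA : RowFinite A) (y z : ℕ → 𝕜) (n : ℕ) :
    transform A (fun k => y k + z k) n = transform A y n + transform A z n := by
  simp only [transform, mul_add]
  exact (hA.summable_mul y n).tsum_add (hA.summable_mul z n)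

theorem transform_ite_mem (A : ℕ → ℕ → 𝕜) (S : Finset ℕ) (x : ℕ → 𝕜) (n : ℕ) :
    transform A (fun k => if k ∈ S then x k else 0) n = ∑ k ∈ S, A n k * x k := by
  rw [transform, tsum_eq_sum (s := S) fun k hk => by rw [if_neg hk, mul_zero]]
  exact sum_congr rfl fun k hk => by rw [if_pos hk]

theorem tsum_enorm_column_ne_top {X : Set (ℕ → 𝕜)} (hAX : Set.MapsTo (transform A) X l1) {k : ℕ}
    (hk : Pi.single k 1 ∈ X) : ∑' n, ‖A n k‖ₑ ≠ ⊤ := by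
  have hcol (n : ℕ) : transform A (Pi.single k 1) n = A n k := by
    rw [transform, tsum_eq_single k fun j hj => by rw [Pi.single_eq_of_ne hj, mul_zero],
      Pi.single_eq_same, mul_one]
  simpa only [hcol] using mem_l1_iff.1 (hAX hk)

end Transform

section FiniteSums

variable {ι : Type*}

theorem tsum_enorm_le_two_mul_iSup (f : ι → ℝ) :
    ∑' i, ‖f i‖ₑ ≤ 2 * ⨆ F : Finset ι, ‖∑ i ∈ F, f i‖ₑ := by
  classical
  have hnonneg (g : ι → ℝ) (S : Finset ι) (hg : ∀ i ∈ S, 0 ≤ g i) :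
      ∑ i ∈ S, ‖g i‖ₑ = ‖∑ i ∈ S, g i‖ₑ := by
    rw [Real.enorm_of_nonneg (sum_nonneg hg), ENNReal.ofReal_sum_of_nonneg hg]
    exact sum_congr rfl fun i hi => Real.enorm_of_nonneg (hg i hi)
  rw [ENNReal.tsum_eq_iSup_sum]
  refine iSup_le fun S => ?_
  rw [← sum_filter_add_sum_filter_not S (0 ≤ f ·), two_mul]
  refine add_le_add ?_ ?_
  · rw [hnonneg f _ fun i hi => (mem_filter.1 hi).2]
    exact le_iSup (fun F : Finset ι => ‖∑ i ∈ F, f i‖ₑ) _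
  · have hneg : ∀ i ∈ S.filter (¬0 ≤ f ·), 0 ≤ -f i := fun i hi =>
      neg_nonneg.2 (not_le.1 (mem_filter.1 hi).2).le
    have hsum := hnonneg (-f ·) _ hneg
    simp only [enorm_neg, sum_neg_distrib] at hsum
    rw [hsum]
    exact le_iSup (fun F : Finset ι => ‖∑ i ∈ F, f i‖ₑ) _

theorem tsum_enorm_le_four_mul_iSup (z : ι → 𝕜) :
    ∑' i, ‖z i‖ₑ ≤ 4 * ⨆ F : Finset ι, ‖∑ i ∈ F, z i‖ₑ := by
  have hle (w : 𝕜) : ‖w‖ₑ ≤ ‖RCLike.re w‖ₑ + ‖RCLike.im w‖ₑ := by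
    calc ‖w‖ₑ = ‖(RCLike.re w : 𝕜) + RCLike.im w * RCLike.I‖ₑ := by rw [RCLike.re_add_im]
      _ ≤ ‖(RCLike.re w : 𝕜)‖ₑ + ‖(RCLike.im w : 𝕜) * RCLike.I‖ₑ := enorm_add_le _ _
      _ ≤ ‖RCLike.re w‖ₑ + ‖RCLike.im w‖ₑ := by
        have hI : ‖(RCLike.im w : 𝕜) * RCLike.I‖ ≤ ‖RCLike.im w‖ := by
          rw [norm_mul, RCLike.norm_ofReal]
          exact mul_le_of_le_one_right (abs_nonneg _)
            (by rw [RCLike.norm_I]; split_ifs <;> norm_num)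
        exact add_le_add (enorm_le_iff_norm_le.2 (by rw [RCLike.norm_ofReal]; rfl))
          (enorm_le_iff_norm_le.2 hI)
  have hre : ∑' i, ‖RCLike.re (z i)‖ₑ ≤ 2 * ⨆ F : Finset ι, ‖∑ i ∈ F, z i‖ₑ := by
    refine (tsum_enorm_le_two_mul_iSup _).trans ?_
    gcongr with F
    rw [← map_sum]
    exact enorm_le_iff_norm_le.2 (RCLike.norm_re_le_norm _)
  have him : ∑' i, ‖RCLike.im (z i)‖ₑ ≤ 2 * ⨆ F : Finset ι, ‖∑ i ∈ F, z i‖ₑ := by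
    refine (tsum_enorm_le_two_mul_iSup _).trans ?_
    gcongr with F
    rw [← map_sum]
    exact enorm_le_iff_norm_le.2 (RCLike.norm_im_le_norm _)
  calc ∑' i, ‖z i‖ₑ ≤ ∑' i, (‖RCLike.re (z i)‖ₑ + ‖RCLike.im (z i)‖ₑ) :=
        ENNReal.tsum_le_tsum fun i => hle (z i)
    _ = ∑' i, ‖RCLike.re (z i)‖ₑ + ∑' i, ‖RCLike.im (z i)‖ₑ := ENNReal.tsum_add
    _ ≤ 4 * ⨆ F : Finset ι, ‖∑ i ∈ F, z i‖ₑ := by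
      refine (add_le_add hre him).trans_eq ?_
      ring

theorem iSup_tsum_enorm_sum_le {κ : Type*} (A : ι → κ → 𝕜) :
    ⨆ G : Finset ι, ∑' k, ‖∑ n ∈ G, A n k‖ₑ ≤ 4 * ⨆ F : Finset κ, ∑' n, ‖∑ k ∈ F, A n k‖ₑ := by
  refine iSup_le fun G => (tsum_enorm_le_four_mul_iSup _).trans ?_
  gcongr with F
  rw [sum_comm]
  exact (enorm_sum_le _ _).trans (ENNReal.sum_le_tsum _)

end FiniteSums

section Sufficiency

variable {A : ℕ → ℕ → 𝕜} {p : ℕ → ℝ}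

theorem RowFinite.transform_mem_l1 (hA : RowFinite A) {y : ℕ → 𝕜} {M : ℝ≥0∞} (hM : M ≠ ⊤)
    (h : ∀ G : Finset ℕ, ∑' k, ‖∑ n ∈ G, A n k‖ₑ * ‖y k‖ₑ ≤ M) : transform A y ∈ l1 := by
  rw [mem_l1_iff]
  refine ne_top_of_le_ne_top (ENNReal.mul_ne_top ENNReal.ofNat_ne_top hM)
    ((tsum_enorm_le_four_mul_iSup _).trans (mul_le_mul_right (iSup_le fun G => ?_) 4))
  refine le_trans ?_ (h G)
  simp only [transform]
  rw [← Summable.tsum_finsetSum fun n _ => hA.summable_mul y n]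
  refine enorm_tsum_le_tsum_enorm.trans_eq (tsum_congr fun k => ?_)
  rw [← sum_mul, enorm_mul]

theorem RowFinite.transform_mem_l1_of_norm_le (hA : RowFinite A) {w : ℕ → ℝ}
    (h : ⨆ F : Finset ℕ, ∑' n, ‖∑ k ∈ F, A n k * (w k : 𝕜)‖ₑ < ⊤) {y : ℕ → 𝕜} {B : ℝ}
    (hy : ∀ k, ‖y k‖ ≤ B * w k) : transform A y ∈ l1 := by
  have hterm (G : Finset ℕ) (k : ℕ) :
      ‖∑ n ∈ G, A n k‖ₑ * ‖y k‖ₑ ≤ ‖B‖ₑ * ‖∑ n ∈ G, A n k * (w k : 𝕜)‖ₑ := by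
    have hyk : ‖y k‖ₑ ≤ ‖B‖ₑ * ‖(w k : 𝕜)‖ₑ := by
      rw [← enorm_norm (w k : 𝕜), RCLike.norm_ofReal, ← Real.norm_eq_abs, enorm_norm, ← enorm_mul]
      exact enorm_le_iff_norm_le.2 ((hy k).trans (le_abs_self _))
    rw [← sum_mul, enorm_mul, mul_left_comm]
    gcongr
  refine hA.transform_mem_l1 (ENNReal.mul_ne_top (enorm_ne_top (x := B))
    (ENNReal.mul_ne_top (ENNReal.ofNat_ne_top (n := 4)) h.ne)) fun G => ?_
  calc ∑' k, ‖∑ n ∈ G, A n k‖ₑ * ‖y k‖ₑ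
      ≤ ∑' k, ‖B‖ₑ * ‖∑ n ∈ G, A n k * (w k : 𝕜)‖ₑ := ENNReal.tsum_le_tsum (hterm G)
    _ = ‖B‖ₑ * ∑' k, ‖∑ n ∈ G, A n k * (w k : 𝕜)‖ₑ := ENNReal.tsum_mul_left
    _ ≤ ‖B‖ₑ * (4 * ⨆ F : Finset ℕ, ∑' n, ‖∑ k ∈ F, A n k * (w k : 𝕜)‖ₑ) := by
      gcongr
      exact (le_iSup (fun G : Finset ℕ => ∑' k, ‖∑ n ∈ G, A n k * (w k : 𝕜)‖ₑ) G).trans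
        (iSup_tsum_enorm_sum_le _)

theorem tsum_ne_top_of_tsum_rpow_ne_top (hp : ∀ k, 0 < p k) (hp1 : ∀ k, p k ≤ 1) {v : ℕ → ℝ≥0∞}
    (hv : ∑' k, v k ^ p k ≠ ⊤) : ∑' k, v k ≠ ⊤ := by
  have hfin : {k | 1 ≤ v k ^ p k}.Finite :=
    ENNReal.finite_const_le_of_tsum_ne_top hv one_ne_zero
  have hv' (k : ℕ) : v k ≠ ⊤ := fun hk =>
    ENNReal.ne_top_of_tsum_ne_top hv k (by rw [hk, ENNReal.top_rpow_of_pos (hp k)])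
  have hle (k : ℕ) : v k ≤ {k | 1 ≤ v k ^ p k}.indicator v k + v k ^ p k := by
    by_cases hk : k ∈ {k | 1 ≤ v k ^ p k}
    · rw [Set.indicator_of_mem hk]
      exact le_self_add
    · rw [Set.indicator_of_notMem hk, zero_add]
      have hvk : v k ≤ 1 := not_lt.1 fun hlt => hk (ENNReal.one_le_rpow hlt.le (hp k))
      simpa using ENNReal.rpow_le_rpow_of_exponent_ge hvk (hp1 k)
  refine ne_top_of_le_ne_top ?_ (ENNReal.tsum_le_tsum hle)
  rw [ENNReal.tsum_add, ← hfin.coe_toFinset, ← sum_eq_tsum_indicator]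
  exact ENNReal.add_ne_top.2 ⟨ENNReal.sum_ne_top.2 fun k _ => hv' k, hv⟩

theorem RowFinite.mapsTo_lp_of_le_one (hA : RowFinite A) (hp : ∀ k, 0 < p k)
    (hp1 : ∀ k, p k ≤ 1)
    (h : (⨆ F : Finset ℕ, ⨆ k : ℕ, ‖∑ n ∈ F, A n k‖ₑ ^ p k) < ⊤) :
    Set.MapsTo (transform A) (lp p) l1 := by
  intro y hy
  set M := ⨆ F : Finset ℕ, ⨆ k : ℕ, ‖∑ n ∈ F, A n k‖ₑ ^ p k
  have hcol (G : Finset ℕ) (k : ℕ) : ‖∑ n ∈ G, A n k‖ₑ ≤ M ^ (1 / p k) := by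
    rw [one_div, ENNReal.le_rpow_inv_iff (hp k)]
    exact le_iSup₂ (f := fun (F : Finset ℕ) k => ‖∑ n ∈ F, A n k‖ₑ ^ p k) G k
  have hsum : ∑' k, M ^ (1 / p k) * ‖y k‖ₑ ≠ ⊤ := by
    refine tsum_ne_top_of_tsum_rpow_ne_top hp hp1 ?_
    have hpow (k : ℕ) : (M ^ (1 / p k) * ‖y k‖ₑ) ^ p k = M * ‖y k‖ₑ ^ p k := by
      rw [ENNReal.mul_rpow_of_nonneg _ _ (hp k).le, ← ENNReal.rpow_mul,
        one_div_mul_cancel (hp k).ne', ENNReal.rpow_one]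
    simp only [hpow]
    rw [ENNReal.tsum_mul_left]
    exact ENNReal.mul_ne_top h.ne ((mem_lp_iff hp).1 hy)
  refine hA.transform_mem_l1 hsum fun G => ENNReal.tsum_le_tsum fun k => ?_
  gcongr
  exact hcol G k

theorem mul_le_rpow_add_rpow (a b : ℝ≥0∞) {q q' : ℝ} (hq : q.HolderConjugate q') :
    a * b ≤ a ^ q + b ^ q' :=
  (ENNReal.young_inequality a b hq).trans <| add_le_add
    (ENNReal.div_le_of_le_mul (le_mul_of_one_le_right' (by simpa using hq.lt.le)))
    (ENNReal.div_le_of_le_mul (le_mul_of_one_le_right' (by simpa using hq.symm.lt.le)))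

theorem RowFinite.mapsTo_lp_of_one_lt (hA : RowFinite A) (hp : ∀ k, 1 < p k) {L : ℕ} (hL : 0 < L)
    (h : (⨆ F : Finset ℕ, ∑' k, ‖∑ n ∈ F, A n k * (L : 𝕜)⁻¹‖ₑ ^ (p k / (p k - 1))) < ⊤) :
    Set.MapsTo (transform A) (lp p) l1 := by
  intro y hy
  set M := ⨆ F : Finset ℕ, ∑' k, ‖∑ n ∈ F, A n k * (L : 𝕜)⁻¹‖ₑ ^ (p k / (p k - 1))
  have hp0 (k : ℕ) : 0 < p k := one_pos.trans (hp k)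
  have hL' : (L : 𝕜) ≠ 0 := Nat.cast_ne_zero.2 hL.ne'
  have hterm (G : Finset ℕ) (k : ℕ) : ‖∑ n ∈ G, A n k‖ₑ * ‖y k‖ₑ ≤
      ‖(L : 𝕜)‖ₑ * (‖∑ n ∈ G, A n k * (L : 𝕜)⁻¹‖ₑ ^ (p k / (p k - 1)) + ‖y k‖ₑ ^ p k) := by
    calc ‖∑ n ∈ G, A n k‖ₑ * ‖y k‖ₑ
        = ‖(L : 𝕜)‖ₑ * (‖∑ n ∈ G, A n k * (L : 𝕜)⁻¹‖ₑ * ‖y k‖ₑ) := by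
          rw [← mul_assoc, ← enorm_mul (L : 𝕜), ← sum_mul, mul_comm (L : 𝕜),
            inv_mul_cancel_right₀ hL']
      _ ≤ _ := by
          gcongr
          exact mul_le_rpow_add_rpow _ _ (Real.HolderConjugate.conjExponent (hp k)).symm
  refine hA.transform_mem_l1 (M := ‖(L : 𝕜)‖ₑ * (M + ∑' k, ‖y k‖ₑ ^ p k))
    (ENNReal.mul_ne_top enorm_ne_top (ENNReal.add_ne_top.2 ⟨h.ne, (mem_lp_iff hp0).1 hy⟩))
    fun G => (ENNReal.tsum_le_tsum (hterm G)).trans ?_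
  rw [ENNReal.tsum_mul_left, ENNReal.tsum_add]
  gcongr
  exact le_iSup
    (fun F : Finset ℕ => ∑' k, ‖∑ n ∈ F, A n k * (L : 𝕜)⁻¹‖ₑ ^ (p k / (p k - 1))) G

end Sufficiency

section GlidingHump

variable {A : ℕ → ℕ → 𝕜}

theorem RowFinite.exists_forall_lt (hA : RowFinite A) (N : ℕ) :
    ∃ K, ∀ n < N, ∀ k ≥ K, A n k = 0 := by
  obtain ⟨K, hK⟩ := eventually_atTop.1 ((eventually_all_finset (range N)).2 fun n _ => hA n)
  exact ⟨K, fun n hn k hk => hK k hk n (mem_range.2 hn)⟩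

theorem RowFinite.enorm_transform_le_add_sum_head (hA : RowFinite A) {n K K' : ℕ} {x z : ℕ → 𝕜}
    (hrow : ∀ k ≥ K', A n k = 0) (hx : ∀ k < K, x k = 0)
    (hxz : ∀ k, K ≤ k → k < K' → z k = x k) :
    ‖transform A x n‖ₑ ≤ ‖transform A z n‖ₑ + ∑ k ∈ range K, ‖A n k‖ₑ * ‖z k‖ₑ := by
  have hsplit : transform A z n = transform A x n + ∑ k ∈ range K, A n k * z k := by
    rw [← transform_ite_mem, ← hA.transform_add]
    refine tsum_congr fun k => ?_
    rcases lt_or_ge k K with hk | hk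
    · simp [hk, hx]
    · rcases lt_or_ge k K' with hk' | hk'
      · simp [hk.not_gt, hxz k hk hk']
      · simp [hrow k hk']
  calc ‖transform A x n‖ₑ = ‖transform A z n - ∑ k ∈ range K, A n k * z k‖ₑ := by
        rw [hsplit, add_sub_cancel_right]
    _ ≤ ‖transform A z n‖ₑ + ‖∑ k ∈ range K, A n k * z k‖ₑ := enorm_sub_le
    _ ≤ ‖transform A z n‖ₑ + ∑ k ∈ range K, ‖A n k‖ₑ * ‖z k‖ₑ := by
      gcongr
      exact (enorm_sum_le _ _).trans_eq (sum_congr rfl fun k _ => enorm_mul _ _)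

theorem exists_tail_le_half {f : ℕ → ℝ≥0∞} (hf : ∑' n, f n ≠ ⊤) :
    ∃ J₀, ∀ J ≥ J₀, ∑' n, f (n + J) ≤ 1 / 2 :=
  eventually_atTop.1 <| (ENNReal.tendsto_sum_nat_add f hf).eventually_le_const (by simp)

theorem RowFinite.exists_lt_sum_transform (hA : RowFinite A) {U : Set (ℕ → 𝕜)}
    (hU : ∀ K, ∃ x ∈ U, (∀ k < K, x k = 0) ∧ 1 < ∑' n, ‖transform A x n‖ₑ) (J K : ℕ) :
    ∃ x ∈ U, (∀ k < K, x k = 0) ∧ ∃ M, 1 < ∑ n ∈ range M, ‖transform A x (n + J)‖ₑ := by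
  obtain ⟨K₀, hK₀⟩ := hA.exists_forall_lt J
  obtain ⟨x, hxU, hx, hlt⟩ := hU (max K K₀)
  have hzero : ∀ n < J, transform A x n = 0 := fun n hn => by
    refine (tsum_congr fun k => ?_).trans tsum_zero
    rcases lt_or_ge k K₀ with hk | hk
    · rw [hx k (lt_max_of_lt_right hk), mul_zero]
    · rw [hK₀ n hn k hk, zero_mul]
  have hhead : ∑ n ∈ range J, ‖transform A x n‖ₑ = 0 :=
    sum_eq_zero fun n hn => by rw [hzero n (mem_range.1 hn), enorm_zero]
  have htail : 1 < ∑' n, ‖transform A x (n + J)‖ₑ := by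
    rwa [← ENNReal.summable.sum_add_tsum_nat_add' (k := J), hhead, zero_add] at hlt
  rw [ENNReal.tsum_eq_iSup_nat] at htail
  exact ⟨x, hxU, fun k hk => hx k (lt_max_of_lt_left hk), lt_iSup_iff.1 htail⟩

-- Rows beyond `J` feel the terms of `z` before `K` only through column tails, which are small,
-- while the finitely many rows carrying the hump of `x` do not reach the terms from `K'` on.
theorem RowFinite.exists_hump (hA : RowFinite A) (hcol : ∀ k, ∑' n, ‖A n k‖ₑ ≠ ⊤)
    {U : Set (ℕ → 𝕜)} (hU : ∀ K, ∃ x ∈ U, (∀ k < K, x k = 0) ∧ 1 < ∑' n, ‖transform A x n‖ₑ)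
    (B : ℕ → ℝ) (K : ℕ) :
    ∃ K' > K, ∃ x ∈ U, ∀ z : ℕ → 𝕜, (∀ k < K, ‖z k‖ ≤ B k) →
      (∀ k, K ≤ k → k < K' → z k = x k) → ∃ J ≥ K, 1 / 2 < ∑' n, ‖transform A z (n + J)‖ₑ := by
  let g : ℕ → ℝ≥0∞ := fun n => ∑ k ∈ range K, ‖A n k‖ₑ * ‖B k‖ₑ
  have hg : ∑' n, g n ≠ ⊤ := by
    rw [Summable.tsum_finsetSum fun _ _ => ENNReal.summable]
    refine ENNReal.sum_ne_top.2 fun k _ => ?_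
    rw [ENNReal.tsum_mul_right]
    exact ENNReal.mul_ne_top (hcol k) enorm_ne_top
  obtain ⟨J₀, hJ₀⟩ := exists_tail_le_half hg
  set J := max K J₀
  obtain ⟨x, hxU, hx, M, hM⟩ := hA.exists_lt_sum_transform hU J K
  obtain ⟨K₁, hK₁⟩ := hA.exists_forall_lt (M + J)
  refine ⟨max K₁ (K + 1), lt_max_of_lt_right K.lt_succ_self, x, hxU, fun z hz hzx =>
    ⟨J, le_max_left _ _, ?_⟩⟩
  have hle : ∀ n ∈ range M, ‖transform A x (n + J)‖ₑ ≤ ‖transform A z (n + J)‖ₑ + g (n + J) := by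
    intro n hn
    have hrow : ∀ k ≥ max K₁ (K + 1), A (n + J) k = 0 := fun k hk =>
      hK₁ _ (Nat.add_lt_add_right (mem_range.1 hn) J) k (le_of_max_le_left hk)
    refine (hA.enorm_transform_le_add_sum_head hrow hx hzx).trans ?_
    refine add_le_add_right (sum_le_sum fun k hk => mul_le_mul_right ?_ _) _
    exact enorm_le_iff_norm_le.2 ((hz k (mem_range.1 hk)).trans (le_abs_self _))
  have hlt : 1 / 2 + 1 / 2 < ∑' n, ‖transform A z (n + J)‖ₑ + 1 / 2 :=
    calc (1 / 2 + 1 / 2 : ℝ≥0∞) = 1 := ENNReal.add_halves 1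
      _ < ∑ n ∈ range M, ‖transform A x (n + J)‖ₑ := hM
      _ ≤ ∑ n ∈ range M, ‖transform A z (n + J)‖ₑ + ∑ n ∈ range M, g (n + J) := by
        rw [← sum_add_distrib]
        exact sum_le_sum hle
      _ ≤ ∑' n, ‖transform A z (n + J)‖ₑ + 1 / 2 :=
        add_le_add (ENNReal.sum_le_tsum _)
          ((ENNReal.sum_le_tsum _).trans (hJ₀ J (le_max_right _ _)))
  exact lt_of_add_lt_add_right hlt

theorem exists_block_index {N : ℕ → ℕ} (hN : StrictMono N) :
    ∃ β : ℕ → ℕ, Tendsto β atTop atTop ∧ ∀ i k, N i ≤ k → k < N (i + 1) → β k = i := by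
  have hex (k : ℕ) : ∃ i, k < N (i + 1) := ⟨k, k.lt_succ_self.trans_le hN.le_apply⟩
  refine ⟨fun k => Nat.find (hex k), tendsto_atTop.2 fun b => ?_, fun i k hik hki => ?_⟩
  · filter_upwards [eventually_ge_atTop (N b)] with k hk
    exact (Nat.le_find_iff _ _).2 fun j hj => not_lt.2 ((hN.monotone hj).trans hk)
  · exact (Nat.find_eq_iff _).2 ⟨hki, fun j hj => not_lt.2 ((hN.monotone hj).trans hik)⟩

theorem RowFinite.exists_tsum_enorm_transform_le_one (hA : RowFinite A) {X : Set (ℕ → 𝕜)}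
    (hAX : Set.MapsTo (transform A) X l1) (hX : ∀ k, Pi.single k 1 ∈ X)
    {U : ℕ → Set (ℕ → 𝕜)} {B : ℕ → ℝ} (hB : ∀ i, ∀ x ∈ U i, ∀ k, ‖x k‖ ≤ B k)
    (hdiag : ∀ (x : ℕ → ℕ → 𝕜) (β : ℕ → ℕ), (∀ i, x i ∈ U i) → Tendsto β atTop atTop →
      (fun k => x (β k) k) ∈ X) :
    ∃ i K, ∀ x ∈ U i, (∀ k < K, x k = 0) → ∑' n, ‖transform A x n‖ₑ ≤ 1 := by
  by_contra! h
  choose next hnext x hxU hhump using fun i =>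
    hA.exists_hump (fun k => tsum_enorm_column_ne_top hAX (hX k)) (h i) B
  let N : ℕ → ℕ := Nat.rec 0 next
  have hN : StrictMono N := strictMono_nat_of_lt_succ fun i => hnext i (N i)
  obtain ⟨β, hβ, hβN⟩ := exists_block_index hN
  let z : ℕ → 𝕜 := fun k => x (β k) (N (β k)) k
  have hz : z ∈ X := hdiag (fun i => x i (N i)) β (fun i => hxU i _) hβ
  obtain ⟨J₀, hJ₀⟩ := exists_tail_le_half (mem_l1_iff.1 (hAX hz))
  obtain ⟨J, hJ, hlt⟩ := hhump J₀ (N J₀) z (fun k _ => hB _ _ (hxU _ _) k)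
    fun k hk hk' => by simp only [z, hβN J₀ k hk hk']
  exact (hJ₀ J (hN.le_apply.trans hJ)).not_gt hlt

end GlidingHump

section Necessity

variable {A : ℕ → ℕ → 𝕜} {p : ℕ → ℝ}

theorem iSup_tsum_enorm_sum_lt_top_of_tail {K : ℕ} (hcol : ∀ k < K, ∑' n, ‖A n k‖ₑ ≠ ⊤)
    {M : ℝ≥0∞} (hM : M ≠ ⊤)
    (htail : ∀ F : Finset ℕ, (∀ k ∈ F, K ≤ k) → ∑' n, ‖∑ k ∈ F, A n k‖ₑ ≤ M) :
    ⨆ F : Finset ℕ, ∑' n, ‖∑ k ∈ F, A n k‖ₑ < ⊤ := by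
  have hhead : ∑ k ∈ range K, ∑' n, ‖A n k‖ₑ ≠ ⊤ :=
    ENNReal.sum_ne_top.2 fun k hk => hcol k (mem_range.1 hk)
  refine (iSup_le fun F => ?_).trans_lt (ENNReal.add_lt_top.2 ⟨hhead.lt_top, hM.lt_top⟩)
  calc ∑' n, ‖∑ k ∈ F, A n k‖ₑ
      ≤ ∑' n, (∑ k ∈ F with k < K, ‖A n k‖ₑ + ‖∑ k ∈ F with ¬k < K, A n k‖ₑ) := by
        refine ENNReal.tsum_le_tsum fun n => ?_
        rw [← sum_filter_add_sum_filter_not F (· < K)]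
        exact (enorm_add_le _ _).trans (add_le_add_left (enorm_sum_le _ _) _)
    _ = ∑ k ∈ F with k < K, ∑' n, ‖A n k‖ₑ + ∑' n, ‖∑ k ∈ F with ¬k < K, A n k‖ₑ := by
        rw [ENNReal.tsum_add, Summable.tsum_finsetSum fun _ _ => ENNReal.summable]
    _ ≤ ∑ k ∈ range K, ∑' n, ‖A n k‖ₑ + M :=
        add_le_add (sum_le_sum_of_subset fun k hk => mem_range.2 (mem_filter.1 hk).2)
          (htail _ fun k hk => not_lt.1 (mem_filter.1 hk).2)

theorem RowFinite.exists_iSup_tsum_enorm_sum_lt_top (hA : RowFinite A) {X : Set (ℕ → 𝕜)}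
    (hAX : Set.MapsTo (transform A) X l1) (hX : ∀ k, Pi.single k 1 ∈ X) {w : ℕ → ℕ → ℝ}
    {B : ℕ → ℝ} (hw : ∀ i k, 0 ≤ w i k) (hwB : ∀ i k, w i k ≤ B k)
    (hdiag : ∀ (x : ℕ → 𝕜) (β : ℕ → ℕ), (∀ k, ‖x k‖ ≤ w (β k) k) → Tendsto β atTop atTop →
      x ∈ X) :
    ∃ i, ⨆ F : Finset ℕ, ∑' n, ‖∑ k ∈ F, A n k * (w i k : 𝕜)‖ₑ < ⊤ := by
  obtain ⟨i, K, hK⟩ := hA.exists_tsum_enorm_transform_le_one hAX hX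
    (U := fun i => {x | ∀ k, ‖x k‖ ≤ w i k}) (fun i x hx k => (hx k).trans (hwB i k))
    fun x β hx hβ => hdiag _ β (fun k => hx (β k) k) hβ
  have hcol (k : ℕ) : ∑' n, ‖A n k * (w i k : 𝕜)‖ₑ ≠ ⊤ := by
    simp only [enorm_mul]
    rw [ENNReal.tsum_mul_right]
    exact ENNReal.mul_ne_top (tsum_enorm_column_ne_top hAX (hX k)) enorm_ne_top
  refine ⟨i, iSup_tsum_enorm_sum_lt_top_of_tail (K := K) (fun k _ => hcol k)
    ENNReal.one_ne_top fun F hF => ?_⟩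
  simp only [← transform_ite_mem]
  refine hK _ (fun k => ?_) fun k hk => if_neg fun hkF => (hF k hkF).not_gt hk
  by_cases hk : k ∈ F
  · simp [hk, abs_of_nonneg (hw i k)]
  · simp [hk, hw i k]

theorem single_mem_lp (hp : ∀ k, 0 < p k) (k : ℕ) : (Pi.single k 1 : ℕ → 𝕜) ∈ lp p := by
  rw [mem_lp_iff hp, tsum_eq_single k fun j hj => by simp [hj, hp j]]
  simp

theorem diagonal_mem_lp (hp : ∀ k, 0 < p k) {x : ℕ → ℕ → 𝕜}
    (hx : ∀ i, ∑' k, ‖x i k‖ₑ ^ p k ≤ 2⁻¹ ^ i) (β : ℕ → ℕ) : (fun k => x (β k) k) ∈ lp p := by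
  rw [mem_lp_iff hp]
  have hle : ∑' k, ‖x (β k) k‖ₑ ^ p k ≤ ∑' i : ℕ, (2⁻¹ : ℝ≥0∞) ^ i :=
    calc ∑' k, ‖x (β k) k‖ₑ ^ p k ≤ ∑' k, ∑' i, ‖x i k‖ₑ ^ p k :=
          ENNReal.tsum_le_tsum fun k => ENNReal.le_tsum (f := fun i => ‖x i k‖ₑ ^ p k) (β k)
      _ = ∑' i, ∑' k, ‖x i k‖ₑ ^ p k := ENNReal.tsum_comm
      _ ≤ ∑' i : ℕ, (2⁻¹ : ℝ≥0∞) ^ i := ENNReal.tsum_le_tsum hx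
  exact ne_top_of_le_ne_top (by simp [ENNReal.tsum_geometric]) hle

theorem RowFinite.exists_enorm_sum_le_one_of_mapsTo_lp (hA : RowFinite A) (hp : ∀ k, 0 < p k)
    (hAp : Set.MapsTo (transform A) (lp p) l1) :
    ∃ δ : ℝ≥0∞, δ ≠ 0 ∧ δ ≠ ⊤ ∧ ∃ K, ∀ G S : Finset ℕ, (∀ k ∈ S, K ≤ k) → ∀ x : ℕ → 𝕜,
      ∑ k ∈ S, ‖x k‖ₑ ^ p k ≤ δ → ‖∑ k ∈ S, (∑ n ∈ G, A n k) * x k‖ₑ ≤ 1 := by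
  have hB : ∀ i, ∀ x ∈ {x : ℕ → 𝕜 | ∑' k, ‖x k‖ₑ ^ p k ≤ 2⁻¹ ^ i}, ∀ k, ‖x k‖ ≤ 1 := by
    intro i x hx k
    have hle : ‖x k‖ₑ ^ p k ≤ 1 :=
      (ENNReal.le_tsum k).trans (hx.trans (pow_le_one₀ zero_le (by simp)))
    have henorm : ‖x k‖ₑ ≤ ‖(1 : ℝ)‖ₑ := by
      rw [enorm_one]
      exact not_lt.1 fun hlt => hle.not_gt (ENNReal.one_lt_rpow hlt (hp k))
    simpa using enorm_le_iff_norm_le.1 henorm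
  obtain ⟨i, K, hK⟩ := hA.exists_tsum_enorm_transform_le_one hAp (single_mem_lp hp) hB
    fun x β hx _ => diagonal_mem_lp hp hx β
  refine ⟨2⁻¹ ^ i, by simp, by simp, K, fun G S hS x hx => ?_⟩
  let y : ℕ → 𝕜 := fun k => if k ∈ S then x k else 0
  have hy : ∑' k, ‖y k‖ₑ ^ p k = ∑ k ∈ S, ‖x k‖ₑ ^ p k := by
    rw [tsum_eq_sum (s := S) fun k hk => by simp [y, hk, hp k]]
    exact sum_congr rfl fun k hk => by simp [y, hk]
  calc ‖∑ k ∈ S, (∑ n ∈ G, A n k) * x k‖ₑ = ‖∑ n ∈ G, transform A y n‖ₑ := by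
        simp only [y, transform_ite_mem, sum_mul]
        rw [sum_comm]
    _ ≤ ∑' n, ‖transform A y n‖ₑ := (enorm_sum_le _ _).trans (ENNReal.sum_le_tsum _)
    _ ≤ 1 := hK y (hy.trans_le hx) fun k hk => if_neg fun hkS => (hS k hkS).not_gt hk

theorem exists_enorm_eq {a : ℝ≥0∞} (ha : a ≠ ⊤) : ∃ x : 𝕜, ‖x‖ₑ = a := by
  refine ⟨(a.toReal : 𝕜), ?_⟩
  rw [← enorm_norm, RCLike.norm_ofReal, abs_of_nonneg ENNReal.toReal_nonneg,
    Real.enorm_of_nonneg ENNReal.toReal_nonneg, ENNReal.ofReal_toReal ha]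

theorem enorm_sum_le_tsum_column (A : ℕ → ℕ → 𝕜) (G : Finset ℕ) (k : ℕ) :
    ‖∑ n ∈ G, A n k‖ₑ ≤ ∑' n, ‖A n k‖ₑ :=
  (enorm_sum_le _ _).trans (ENNReal.sum_le_tsum _)

theorem RowFinite.iSup_rpow_lt_top_of_mapsTo_lp (hA : RowFinite A) (hp : ∀ k, 0 < p k)
    (hAp : Set.MapsTo (transform A) (lp p) l1) :
    (⨆ F : Finset ℕ, ⨆ k : ℕ, ‖∑ n ∈ F, A n k‖ₑ ^ p k) < ⊤ := by
  obtain ⟨δ, hδ0, hδ, K, hK⟩ := hA.exists_enorm_sum_le_one_of_mapsTo_lp hp hAp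
  have hcol (k : ℕ) := tsum_enorm_column_ne_top hAp (single_mem_lp hp k)
  have hlarge (G : Finset ℕ) (k : ℕ) (hk : K ≤ k) : ‖∑ n ∈ G, A n k‖ₑ ^ p k ≤ δ⁻¹ := by
    obtain ⟨x, hx⟩ := exists_enorm_eq (𝕜 := 𝕜) (a := δ ^ (p k)⁻¹)
      (ENNReal.rpow_ne_top_of_nonneg (inv_nonneg.2 (hp k).le) hδ)
    have hxp : ‖x‖ₑ ^ p k = δ := by rw [hx, ENNReal.rpow_inv_rpow (hp k).ne']
    have hle := hK G {k} (by simpa using hk) (fun _ => x) (by simp [hxp])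
    rw [sum_singleton, enorm_mul] at hle
    rw [ENNReal.le_inv_iff_mul_le, ← hxp, ← ENNReal.mul_rpow_of_nonneg _ _ (hp k).le]
    exact ENNReal.rpow_le_one hle (hp k).le
  refine lt_of_le_of_lt (b := δ⁻¹ + ∑ k ∈ range K, (∑' n, ‖A n k‖ₑ) ^ p k)
    (iSup₂_le fun G k => ?_) (ENNReal.add_lt_top.2 ⟨(ENNReal.inv_ne_top.2 hδ0).lt_top,
      (ENNReal.sum_ne_top.2 fun k _ => ENNReal.rpow_ne_top_of_nonneg (hp k).le (hcol k)).lt_top⟩)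
  rcases le_or_gt K k with hk | hk
  · exact (hlarge G k hk).trans le_self_add
  · refine (ENNReal.rpow_le_rpow (enorm_sum_le_tsum_column A G k) (hp k).le).trans ?_
    exact (single_le_sum (f := fun k => (∑' n, ‖A n k‖ₑ) ^ p k) (fun _ _ => zero_le)
      (mem_range.2 hk)).trans le_add_self

-- For `d ≠ 0` the witness is `|d|^(q' - 2) · conj d`, the derivative of `|d|^q' / q'`.
theorem exists_norming {q q' : ℝ} (hq : q.HolderConjugate q') (d : 𝕜) :
    ∃ z : 𝕜, ‖z‖ₑ ^ q = ‖d‖ₑ ^ q' ∧ d * z = ((‖d‖ ^ q' : ℝ) : 𝕜) := by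
  rcases eq_or_ne d 0 with rfl | hd
  · exact ⟨0, by simp [hq.pos, hq.symm.pos], by simp [Real.zero_rpow hq.symm.ne_zero]⟩
  · have hd' : 0 < ‖d‖ := norm_pos_iff.2 hd
    refine ⟨((‖d‖ ^ (q' - 2) : ℝ) : 𝕜) * starRingEnd 𝕜 d, ?_, ?_⟩
    · have hnorm : ‖((‖d‖ ^ (q' - 2) : ℝ) : 𝕜) * starRingEnd 𝕜 d‖ = ‖d‖ ^ (q' - 1) := by
        rw [norm_mul, RCLike.norm_conj, RCLike.norm_ofReal,
          abs_of_nonneg (Real.rpow_nonneg hd'.le _), ← Real.rpow_add_one hd'.ne']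
        ring_nf
      have henorm : ‖((‖d‖ ^ (q' - 2) : ℝ) : 𝕜) * starRingEnd 𝕜 d‖ₑ = ‖d‖ₑ ^ (q' - 1) := by
        rw [← enorm_norm, hnorm, Real.enorm_rpow_of_nonneg hd'.le hq.symm.sub_one_pos.le,
          enorm_norm]
      rw [henorm, ← ENNReal.rpow_mul, hq.symm.sub_one_mul_conj]
    · rw [mul_left_comm, RCLike.mul_conj, ← RCLike.ofReal_pow, ← RCLike.ofReal_mul,
        ← Real.rpow_natCast, ← Real.rpow_add hd']
      congr 2
      push_cast
      ring

theorem sum_enorm_rpow_le_of_forall_enorm_sum_lt {ι : Type*} {p q : ι → ℝ}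
    (hpq : ∀ k, (p k).HolderConjugate (q k)) {S : Finset ι} {d : ι → 𝕜} {δ : ℝ≥0∞}
    (h : ∀ x : ι → 𝕜, ∑ k ∈ S, ‖x k‖ₑ ^ p k ≤ δ → ‖∑ k ∈ S, d k * x k‖ₑ < δ) :
    ∑ k ∈ S, ‖d k‖ₑ ^ q k ≤ δ := by
  set σ := ∑ k ∈ S, ‖d k‖ₑ ^ q k
  by_contra! hlt
  choose z hzp hz using fun k => exists_norming (hpq k) (d k)
  have hσ0 : σ ≠ 0 := (pos_of_gt hlt).ne'
  have hσt : σ ≠ ⊤ := ENNReal.sum_ne_top.2 fun k _ =>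
    ENNReal.rpow_ne_top_of_nonneg (hpq k).symm.nonneg enorm_ne_top
  have hδσ : δ / σ ≤ 1 := ENNReal.div_le_of_le_mul (by rw [one_mul]; exact hlt.le)
  obtain ⟨θ, hθ⟩ := exists_enorm_eq (𝕜 := 𝕜) (ne_top_of_le_ne_top ENNReal.one_ne_top hδσ)
  have hsmall : ∑ k ∈ S, ‖θ * z k‖ₑ ^ p k ≤ δ :=
    calc ∑ k ∈ S, ‖θ * z k‖ₑ ^ p k ≤ ∑ k ∈ S, δ / σ * ‖d k‖ₑ ^ q k := by
          refine sum_le_sum fun k _ => ?_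
          rw [enorm_mul, ENNReal.mul_rpow_of_nonneg _ _ (hpq k).nonneg, hθ, hzp]
          gcongr
          simpa using ENNReal.rpow_le_rpow_of_exponent_ge hδσ (hpq k).lt.le
      _ = δ := by rw [← mul_sum, ENNReal.div_mul_cancel hσ0 hσt]
  have hpair : ∑ k ∈ S, d k * (θ * z k) = θ * ((∑ k ∈ S, ‖d k‖ ^ q k : ℝ) : 𝕜) := by
    rw [RCLike.ofReal_sum, mul_sum]
    exact sum_congr rfl fun k _ => by rw [mul_left_comm, hz]
  have hnorm : ‖((∑ k ∈ S, ‖d k‖ ^ q k : ℝ) : 𝕜)‖ₑ = σ := by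
    have hnonneg : ∀ k ∈ S, 0 ≤ ‖d k‖ ^ q k := fun k _ => Real.rpow_nonneg (norm_nonneg _) _
    rw [← enorm_norm, RCLike.norm_ofReal, abs_of_nonneg (sum_nonneg hnonneg),
      Real.enorm_of_nonneg (sum_nonneg hnonneg), ENNReal.ofReal_sum_of_nonneg hnonneg]
    exact sum_congr rfl fun k _ => by
      rw [← Real.enorm_of_nonneg (Real.rpow_nonneg (norm_nonneg _) _),
        Real.enorm_rpow_of_nonneg (norm_nonneg _) (hpq k).symm.nonneg, enorm_norm]
  refine (h _ hsmall).ne ?_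
  rw [hpair, enorm_mul, hθ, hnorm, ENNReal.div_mul_cancel hσ0 hσt]

theorem RowFinite.exists_iSup_tsum_rpow_lt_top_of_mapsTo_lp (hA : RowFinite A)
    (hp : ∀ k, 1 < p k) (hAp : Set.MapsTo (transform A) (lp p) l1) :
    ∃ L : ℕ, 0 < L ∧
      (⨆ F : Finset ℕ, ∑' k, ‖∑ n ∈ F, A n k * (L : 𝕜)⁻¹‖ₑ ^ (p k / (p k - 1))) < ⊤ := by
  have hp0 (k : ℕ) : 0 < p k := one_pos.trans (hp k)
  have hpq (k : ℕ) : (p k).HolderConjugate (p k / (p k - 1)) := .conjExponent (hp k)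
  obtain ⟨δ, hδ0, hδ, K, hK⟩ := hA.exists_enorm_sum_le_one_of_mapsTo_lp hp0 hAp
  obtain ⟨L, hL⟩ := ENNReal.exists_nat_gt (ENNReal.inv_ne_top.2 hδ0)
  have hL0 : 0 < L := Nat.cast_pos.1 (pos_of_gt hL)
  have hLδ : ‖(L : 𝕜)⁻¹‖ₑ < δ := by
    rw [enorm_inv (Nat.cast_ne_zero.2 hL0.ne'), ENNReal.inv_lt_iff_inv_lt]
    simpa [← enorm_norm (L : 𝕜)] using hL
  have htail (G S : Finset ℕ) (hS : ∀ k ∈ S, K ≤ k) :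
      ∑ k ∈ S, ‖∑ n ∈ G, A n k * (L : 𝕜)⁻¹‖ₑ ^ (p k / (p k - 1)) ≤ δ := by
    refine sum_enorm_rpow_le_of_forall_enorm_sum_lt hpq fun x hx => ?_
    have hfactor : ∑ k ∈ S, (∑ n ∈ G, A n k * (L : 𝕜)⁻¹) * x k =
        (L : 𝕜)⁻¹ * ∑ k ∈ S, (∑ n ∈ G, A n k) * x k := by
      rw [mul_sum]
      exact sum_congr rfl fun k _ => by rw [← sum_mul]; ring
    rw [hfactor, enorm_mul]
    exact (mul_le_of_le_one_right zero_le (hK G S hS x hx)).trans_lt hLδ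
  have hcol (k : ℕ) : ∑' n, ‖A n k * (L : 𝕜)⁻¹‖ₑ ≠ ⊤ := by
    simp only [enorm_mul]
    rw [ENNReal.tsum_mul_right]
    exact ENNReal.mul_ne_top (tsum_enorm_column_ne_top hAp (single_mem_lp hp0 k)) enorm_ne_top
  refine ⟨L, hL0, lt_of_le_of_lt
    (b := ∑ k ∈ range K, (∑' n, ‖A n k * (L : 𝕜)⁻¹‖ₑ) ^ (p k / (p k - 1)) + δ)
    (iSup_le fun G => ?_) (ENNReal.add_lt_top.2 ⟨(ENNReal.sum_ne_top.2 fun k _ =>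
      ENNReal.rpow_ne_top_of_nonneg (hpq k).symm.nonneg (hcol k)).lt_top, hδ.lt_top⟩)⟩
  rw [ENNReal.tsum_eq_iSup_sum]
  refine iSup_le fun S => ?_
  rw [← sum_filter_add_sum_filter_not S (· < K)]
  refine add_le_add ?_ (htail G _ fun k hk => not_lt.1 (mem_filter.1 hk).2)
  refine (sum_le_sum fun k _ => ENNReal.rpow_le_rpow
    (enorm_sum_le_tsum_column (fun n k => A n k * (L : 𝕜)⁻¹) G k) (hpq k).symm.nonneg).trans ?_
  exact sum_le_sum_of_subset fun k hk => mem_range.2 (mem_filter.1 hk).2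

end Necessity

section Characterizations

variable {A : ℕ → ℕ → 𝕜} {p : ℕ → ℝ}

theorem RowFinite.mapsTo_lp_iff_of_one_lt (hA : RowFinite A) (hp : ∀ k, 1 < p k) :
    Set.MapsTo (transform A) (lp p) l1 ↔ ∃ L : ℕ, 0 < L ∧
      (⨆ F : Finset ℕ, ∑' k, ‖∑ n ∈ F, A n k * (L : 𝕜)⁻¹‖ₑ ^ (p k / (p k - 1))) < ⊤ :=
  ⟨hA.exists_iSup_tsum_rpow_lt_top_of_mapsTo_lp hp,
    fun ⟨_, hL, h⟩ => hA.mapsTo_lp_of_one_lt hp hL h⟩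

theorem RowFinite.mapsTo_lp_iff_of_le_one (hA : RowFinite A) (hp : ∀ k, 0 < p k)
    (hp1 : ∀ k, p k ≤ 1) :
    Set.MapsTo (transform A) (lp p) l1 ↔
      (⨆ F : Finset ℕ, ⨆ k : ℕ, ‖∑ n ∈ F, A n k‖ₑ ^ p k) < ⊤ :=
  ⟨hA.iSup_rpow_lt_top_of_mapsTo_lp hp, hA.mapsTo_lp_of_le_one hp hp1⟩

theorem single_mem_c0 (hp : ∀ k, 0 < p k) (k : ℕ) : (Pi.single k 1 : ℕ → 𝕜) ∈ c0 p := by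
  refine tendsto_const_nhds.congr' ?_
  filter_upwards [eventually_gt_atTop k] with j hj
  rw [Pi.single_eq_of_ne hj.ne', norm_zero, Real.zero_rpow (hp j).ne']

theorem norm_rpow_le_of_norm_le_rpow {q : ℝ} (hq : 0 < q) {x : 𝕜} {a : ℝ} (ha : 0 ≤ a)
    (hx : ‖x‖ ≤ a ^ (1 / q)) : ‖x‖ ^ q ≤ a := by
  rw [one_div] at hx
  exact (Real.le_rpow_inv_iff_of_pos (norm_nonneg x) ha hq).1 hx

theorem RowFinite.mapsTo_c0_iff (hA : RowFinite A) (hp : ∀ k, 0 < p k) :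
    Set.MapsTo (transform A) (c0 p) l1 ↔ ∃ L : ℕ, 0 < L ∧
      (⨆ F : Finset ℕ, ∑' n, ‖∑ k ∈ F, A n k * (((L : ℝ) ^ (-1 / p k) : ℝ) : 𝕜)‖ₑ) < ⊤ := by
  have hweight (L k : ℕ) : (L : ℝ) ^ (-1 / p k) = (L : ℝ)⁻¹ ^ (1 / p k) := by
    rw [neg_div, Real.rpow_neg L.cast_nonneg, Real.inv_rpow L.cast_nonneg]
  constructor
  · intro hAX
    obtain ⟨i, hi⟩ := hA.exists_iSup_tsum_enorm_sum_lt_top hAX (single_mem_c0 hp)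
      (w := fun i k => ((i + 1 : ℕ) : ℝ) ^ (-1 / p k)) (B := fun _ => 1)
      (fun i k => by positivity)
      (fun i k => Real.rpow_le_one_of_one_le_of_nonpos (by simp)
        (div_nonpos_of_nonpos_of_nonneg (by norm_num) (hp k).le))
      fun x β hx hβ => by
        refine squeeze_zero (fun k => by positivity)
          (fun k => norm_rpow_le_of_norm_le_rpow (hp k) (by positivity)
            ((hx k).trans_eq (hweight _ k)))
          (tendsto_inv_atTop_nhds_zero_nat.comp ((tendsto_add_atTop_nat 1).comp hβ))
    exact ⟨i + 1, i.succ_pos, hi⟩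
  · rintro ⟨L, hL, h⟩ y hy
    have hw (k : ℕ) : 0 < (L : ℝ) ^ (-1 / p k) := by positivity
    have hbdd : BddAbove (Set.range fun k => ‖y k‖ / (L : ℝ) ^ (-1 / p k)) := by
      refine IsBoundedUnder.bddAbove_range ⟨1, ?_⟩
      rw [eventually_map]
      filter_upwards [hy.eventually_le_const (inv_pos.2 (Nat.cast_pos.2 hL))] with k hk
      rw [div_le_one (hw k), hweight, one_div]
      exact (Real.le_rpow_inv_iff_of_pos (norm_nonneg _) (by positivity) (hp k)).2 hk
    obtain ⟨B, hB⟩ := hbdd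
    exact hA.transform_mem_l1_of_norm_le h fun k => (div_le_iff₀ (hw k)).1 (hB ⟨k, rfl⟩)

theorem RowFinite.mapsTo_c_iff (hA : RowFinite A) (hp : ∀ k, 0 < p k) :
    Set.MapsTo (transform A) (c p) l1 ↔
      Set.MapsTo (transform A) (c0 p) l1 ∧ ∑' n, ‖∑' k, A n k‖ₑ < ⊤ := by
  have hone : transform A 1 = fun n => ∑' k, A n k := by
    funext n
    simp [transform]
  constructor
  · intro hAX
    refine ⟨fun y hy => hAX ⟨0, by simp only [sub_zero]; exact hy⟩, ?_⟩
    have hc : (1 : ℕ → 𝕜) ∈ c p := ⟨1, by simp [Real.zero_rpow (hp _).ne']⟩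
    have hmem := mem_l1_iff.1 (hAX hc)
    rw [hone] at hmem
    exact hmem.lt_top
  · rintro ⟨hc0, hrow⟩ y ⟨l, hl⟩
    have hdecomp (n : ℕ) :
        transform A y n = transform A (fun k => y k - l) n + (∑' k, A n k) * l := by
      have hconst : transform A (fun _ => l) n = (∑' k, A n k) * l := tsum_mul_right
      rw [← hconst, ← hA.transform_add]
      simp only [sub_add_cancel]
    have hsum : Summable fun n => ‖(∑' k, A n k) * l‖ := by
      simp only [norm_mul]
      exact (tsum_enorm_ne_top_iff_summable_norm.1 hrow.ne).mul_right _
    refine Summable.of_nonneg_of_le (fun n => norm_nonneg _) (fun n => ?_)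
      (Summable.add (hc0 hl) hsum)
    rw [hdecomp]
    exact norm_add_le _ _

theorem single_mem_linf (hp : ∀ k, 0 < p k) (k : ℕ) : (Pi.single k 1 : ℕ → 𝕜) ∈ linf p := by
  have hlim : Tendsto (fun j => ‖(Pi.single k 1 : ℕ → 𝕜) j‖ ^ p j) atTop (nhds 0) :=
    single_mem_c0 hp k
  exact hlim.bddAbove_range

theorem RowFinite.mapsTo_linf_iff (hA : RowFinite A) (hp : ∀ k, 0 < p k) :
    Set.MapsTo (transform A) (linf p) l1 ↔ ∀ L : ℕ, 0 < L →
      (⨆ F : Finset ℕ, ∑' n, ‖∑ k ∈ F, A n k * (((L : ℝ) ^ (1 / p k) : ℝ) : 𝕜)‖ₑ) < ⊤ := by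
  constructor
  · intro hAX L _
    obtain ⟨_, h⟩ := hA.exists_iSup_tsum_enorm_sum_lt_top hAX (single_mem_linf hp)
      (w := fun _ k => (L : ℝ) ^ (1 / p k)) (fun _ k => by positivity) (fun _ _ => le_rfl)
      fun x _ hx _ => ⟨L, Set.forall_mem_range.2 fun k =>
        norm_rpow_le_of_norm_le_rpow (hp k) L.cast_nonneg (hx k)⟩
    exact h
  · rintro h y ⟨b, hb⟩
    obtain ⟨L, hL⟩ := exists_nat_ge (max b 1)
    have hL1 : 0 < L := Nat.cast_pos.1 (one_pos.trans_le ((le_max_right b 1).trans hL))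
    refine hA.transform_mem_l1_of_norm_le (h L hL1) (B := 1) fun k => ?_
    rw [one_mul, one_div]
    exact (Real.le_rpow_inv_iff_of_pos (norm_nonneg _) L.cast_nonneg (hp k)).2
      ((hb ⟨k, rfl⟩).trans ((le_max_left b 1).trans hL))

end Characterizations

end GenMeans

theorem theorem4p3_general {𝕜 : Type*} [RCLike 𝕜] (r s t : ℕ → 𝕜) (p : ℕ → ℝ)
    (hr : ∀ n, r n ≠ 0) (ht : ∀ n, t n ≠ 0) (hs : s 0 ≠ 0) (hp : ∀ k, 0 < p k) :
    ((∀ k, 1 < p k) →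
      GenMeans.alphaDual (GenMeans.space (GenMeans.lp p) r s t) = GenMeans.H5 r s t p) ∧
    ((∀ k, p k ≤ 1) →
      GenMeans.alphaDual (GenMeans.space (GenMeans.lp p) r s t) = GenMeans.H4 r s t p) ∧
    GenMeans.alphaDual (GenMeans.space (GenMeans.c0 p) r s t) = GenMeans.H1 r s t p ∧
    GenMeans.alphaDual (GenMeans.space (GenMeans.c p) r s t) =
      GenMeans.H1 r s t p ∩ GenMeans.H2 r s t ∧
    GenMeans.alphaDual (GenMeans.space (GenMeans.linf p) r s t) = GenMeans.H3 r s t p := by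
  have hdual := GenMeans.mem_alphaDual_space_iff hr hs ht
  have hC := GenMeans.rowFinite_C r s t
  exact ⟨fun hp1 => Set.ext fun a => (hdual _ a).trans ((hC a).mapsTo_lp_iff_of_one_lt hp1),
    fun hp1 => Set.ext fun a => (hdual _ a).trans ((hC a).mapsTo_lp_iff_of_le_one hp hp1),
    Set.ext fun a => (hdual _ a).trans ((hC a).mapsTo_c0_iff hp),
    Set.ext fun a => (hdual _ a).trans (((hC a).mapsTo_c_iff hp).trans
      (and_congr_left' ((hC a).mapsTo_c0_iff hp))),
    Set.ext fun a => (hdual _ a).trans ((hC a).mapsTo_linf_iff hp)⟩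

theorem theorem4p3 {𝕜 : Type*} [RCLike 𝕜] (r s t : ℕ → 𝕜) (p : ℕ → ℝ)
    (hr : ∀ n, r n ≠ 0) (ht : ∀ n, t n ≠ 0) (hs : s 0 ≠ 0)
    (hp : ∀ k, 0 < p k) (hpb : BddAbove (Set.range p)) :
    ((∀ k, 1 < p k) →
      GenMeans.alphaDual (GenMeans.space (GenMeans.lp p) r s t) = GenMeans.H5 r s t p) ∧
    ((∀ k, p k ≤ 1) →
      GenMeans.alphaDual (GenMeans.space (GenMeans.lp p) r s t) = GenMeans.H4 r s t p) ∧
    GenMeans.alphaDual (GenMeans.space (GenMeans.c0 p) r s t) = GenMeans.H1 r s t p ∧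
    GenMeans.alphaDual (GenMeans.space (GenMeans.c p) r s t) =
      GenMeans.H1 r s t p ∩ GenMeans.H2 r s t ∧
    GenMeans.alphaDual (GenMeans.space (GenMeans.linf p) r s t) = GenMeans.H3 r s t p :=
  theorem4p3_general r s t p hr ht hs hp
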